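/- For real $\alpha,\beta$ and $\gamma\in(0,\frac{\pi}{2})$ let $$P_{\alpha,\beta,\gamma}(\varphi)=\varphi^2+4\varphi\cos\alpha\cos\beta+4\,\frac{(\cos^2\alpha-\cos^2\gamma)(\cos^2\beta-\cos^2\gamma)}{\sin^2\gamma},$$ and let $P_{\alpha,\beta,\frac{\pi}{2}}(\varphi)=\varphi+2\cos\alpha\cos\beta$. Let $a,b$ be coprime positive integers with $a$ odd, let $c$ be a positive integer, and let $\alpha=\frac{i\pi}{a}$, $\beta=\frac{j\pi}{b}$, $\gamma_1=\frac{k_1\pi}{c}$, $\gamma_2=\frac{k_2\pi}{c}$ with integers $1\le i\le\frac{a-1}{2}$, $1\le j\le b-1$, $1\le k_1,k_2\le\frac{c}{2}$ and $\gamma_1\ne\gamma_2$. Then $P_{\alpha,\beta,\gamma_1}$ and $P_{\alpha,\beta,\gamma_2}$ have a common (complex) root if and only if * either the two polynomials are equal, or $\beta=\frac{\pi}{2}$ and $\{\gamma_1,\gamma_2\}=\{\frac{\pi}{2},\alpha\}$ (in which case they are $\varphi$ and $\varphi^2$), and * up to exchanging $\gamma_1$ and $\gamma_2$, one of the following cases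 occurs: 1. $\sin\alpha=\sin\gamma_1$ and $\sin\beta=\sin\gamma_2$; 2. $\beta\in\{\frac{\pi}{6},\frac{5\pi}{6}\}$, $\gamma_1=\frac{\alpha}{2}$ and $\gamma_2=\frac{\pi}{2}-\frac{\alpha}{2}$. In case 1 the common roots are exactly $\varphi=0$ and $\varphi=-4\cos\alpha\cos\beta$. In case 2 the common roots are exactly $\varphi=-2\cos(\alpha\pm\beta)$; for $\beta=\frac{\pi}{6}$ these are $-2\cos(\alpha\pm\frac{\pi}{6})$. -/

import Mathlib

/-!
Completing the square, `φ` is a root of `P_{α,β,γ}` iff `(φ + 2 cos α cos β) ^ 2` equals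
`4 cos² γ (1 - (sin α sin β / sin γ) ^ 2)`. Equating this expression at `γ₁ ≠ γ₂` shows that a
common root exists only if `sin α sin β = sin γ₁ sin γ₂`. With `x = exp (iα)`, `y = exp (iβ)`,
`u = exp (i(γ₁ + γ₂))` and `v = -exp (i(γ₁ - γ₂))` this becomes the relation
`(x - x⁻¹) * (y - y⁻¹) = u + u⁻¹ + v + v⁻¹` between roots of unity.

Let `p` be an odd prime dividing the order of `x²`, so that `p` does not divide the order of `y²`.
Split every root of unity in the relation into its `p`-primary part and a part of order prime to
`p`, and collect the terms with the same `p`-primary part. Galois conjugation shows that the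
resulting coefficients are constant on the cosets of the `p`-th roots of unity. If `p ≥ 5`, there
are too few terms for a nonzero constant on the coset of the `p`-primary part of `x`, so the
coefficients there vanish. If no such `p` exists, the order of `x²` is a power of `3`, and nonzero
coefficients on this coset would force `|y - y⁻¹| = 1`, by Kronecker's theorem in one case; then
`y²` would have order `6`, although `3` does not divide `b`.

Hence `x * (y - y⁻¹)` is a sum `u' + v'` with `u' ∈ {u, u⁻¹}` and `v' ∈ {v, v⁻¹}`, or equals one of
these four numbers. The sum gives the first case of the theorem, `u^{±1}` is excluded by the sign of
the real part, and `v^{±1}` gives `sin β = 1/2` and `γ₁ + γ₂ = π/2`, which is the second case.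
-/

open scoped Polynomial

/-- The polynomial `P_{α,β,γ}` in the variable `φ`: of degree one when `γ = π/2`,
of degree two otherwise. -/
noncomputable def factorPoly (α β γ : ℝ) : ℝ[X] :=
  open Classical in
  if γ = Real.pi / 2 then
    Polynomial.X + Polynomial.C (2 * Real.cos α * Real.cos β)
  else
    Polynomial.X ^ 2 + Polynomial.C (4 * Real.cos α * Real.cos β) * Polynomial.X
      + Polynomial.C (4 * ((Real.cos α ^ 2 - Real.cos γ ^ 2) * (Real.cos β ^ 2 - Real.cos γ ^ 2))
          / Real.sin γ ^ 2)

/-- `φ` is a common (complex) root of the real polynomials `P` and `Q`. -/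
def IsCommonRoot (P Q : ℝ[X]) (φ : ℂ) : Prop :=
  Polynomial.aeval φ P = 0 ∧ Polynomial.aeval φ Q = 0

/-- First case: `sin α = sin γ₁` and `sin β = sin γ₂`, up to exchanging `γ₁` and `γ₂`. -/
def SineCase (α β γ₁ γ₂ : ℝ) : Prop :=
  (Real.sin α = Real.sin γ₁ ∧ Real.sin β = Real.sin γ₂) ∨
  (Real.sin α = Real.sin γ₂ ∧ Real.sin β = Real.sin γ₁)

/-- Second case: `β` is `π/6` or `5π/6`, and `γ₁ = α/2`, `γ₂ = π/2 - α/2`,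
up to exchanging `γ₁` and `γ₂`. -/
def SixthCase (α β γ₁ γ₂ : ℝ) : Prop :=
  (β = Real.pi / 6 ∨ β = 5 * Real.pi / 6) ∧
  ((γ₁ = α / 2 ∧ γ₂ = Real.pi / 2 - α / 2) ∨
   (γ₂ = α / 2 ∧ γ₁ = Real.pi / 2 - α / 2))

section RootsOfUnity

variable {K : Type*} [Field K]

/-- A relation among powers of `ζ` is a polynomial multiple of the minimal polynomial of `ζ`,
of which `ζ ^ k` is another root. -/
theorem sum_pow_eq_zero_of_coprime [CharZero K] {N k : ℕ} [NeZero N] {ζ : K}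
    (hζ : IsPrimitiveRoot ζ N) (hk : k.Coprime N) {ι : Type*} (s : Finset ι) {τ : ι → K}
    (hτ : ∀ i, τ i ^ N = 1) (h : ∑ i ∈ s, τ i = 0) : ∑ i ∈ s, τ i ^ k = 0 := by
  choose e _ he using fun i => hζ.eq_pow_of_pow_eq_one (hτ i)
  let f : ℤ[X] := ∑ i ∈ s, Polynomial.X ^ e i
  have aeval_f (z : K) : Polynomial.aeval z f = ∑ i ∈ s, z ^ e i := by simp [f]
  have minpoly_dvd : minpoly ℤ (ζ ^ k) ∣ f := by
    rw [← hζ.minpoly_eq_pow_coprime hk]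
    refine minpoly.isIntegrallyClosed_dvd (hζ.isIntegral (NeZero.pos N)) ?_
    simp_rw [aeval_f, he, h]
  simp_rw [← he, pow_right_comm ζ _ k, ← aeval_f]
  exact Polynomial.aeval_eq_zero_of_dvd_aeval_eq_zero minpoly_dvd (minpoly.aeval ℤ _)

theorem sum_mul_pow_eq_zero_of_not_dvd [CharZero K] {p n M t : ℕ} (hp : p.Prime) (hpM : ¬p ∣ M)
    {ζ : K} (hζ : IsPrimitiveRoot ζ (M * p ^ n)) {ι : Type*} (s : Finset ι) {w g : ι → K}
    (hw : ∀ i, w i ^ M = 1) (hg : ∀ i, g i ^ p ^ n = 1) (h : ∑ i ∈ s, w i * g i = 0)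
    (ht : ¬p ∣ t) : ∑ i ∈ s, w i * g i ^ t = 0 := by
  have coprime_pow {m : ℕ} (hm : ¬p ∣ m) : m.Coprime (p ^ n) :=
    ((hp.coprime_iff_not_dvd.2 hm).pow_left n).symm
  have : NeZero (M * p ^ n) :=
    ⟨mul_ne_zero (fun hM => hpM (hM ▸ dvd_zero p)) (pow_ne_zero n hp.ne_zero)⟩
  obtain ⟨k, hkM, hkp⟩ := Nat.chineseRemainder (coprime_pow hpM) 1 t
  have hk : k.Coprime (M * p ^ n) := by
    refine Nat.Coprime.mul_right ?_ (hkp.gcd_eq.trans (coprime_pow ht))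
    exact hkM.gcd_eq.trans (Nat.gcd_one_left M)
  have hpow : ∀ i, (w i * g i) ^ (M * p ^ n) = 1 := fun i => by
    rw [mul_pow, pow_mul, hw, one_pow, pow_mul', hg, one_pow, one_mul]
  rw [← sum_pow_eq_zero_of_coprime hζ hk s hpow h]
  refine Finset.sum_congr rfl fun i _ => ?_
  rw [mul_pow, pow_eq_pow_of_modEq hkM (hw i), pow_eq_pow_of_modEq hkp (hg i), pow_one]

theorem natCast_mul_sum_filter_eq [DecidableEq K] {q : ℕ} {ι : Type*} (s : Finset ι) (w : ι → K)
    {g : ι → K} (hg : ∀ i, g i ^ q = 1) {h : K} (h0 : h ≠ 0) (hh : h ^ q = 1) :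
    (q : K) * ∑ i ∈ s with g i = h, w i =
      ∑ t ∈ Finset.range q, (∑ i ∈ s, w i * g i ^ t) * (h ^ t)⁻¹ := by
  have geom_sum (i : ι) :
      ∑ t ∈ Finset.range q, (g i / h) ^ t = if g i = h then (q : K) else 0 := by
    split_ifs with hi
    · simp [hi, div_self h0]
    · rw [geom_sum_eq (by rwa [ne_eq, div_eq_one_iff_eq h0]), div_pow, hg, hh]
      simp
  calc (q : K) * ∑ i ∈ s with g i = h, w i
      = ∑ i ∈ s, w i * ∑ t ∈ Finset.range q, (g i / h) ^ t := by
        simp_rw [geom_sum, Finset.sum_filter, Finset.mul_sum, mul_ite, mul_zero, mul_comm]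
    _ = ∑ t ∈ Finset.range q, (∑ i ∈ s, w i * g i ^ t) * (h ^ t)⁻¹ := by
        simp_rw [Finset.mul_sum, Finset.sum_mul, div_pow, div_eq_mul_inv, mul_assoc]
        exact Finset.sum_comm

theorem sum_filter_eq_of_pow_eq [CharZero K] [DecidableEq K] {p n M : ℕ} (hp : p.Prime)
    (hpM : ¬p ∣ M) {ζ : K} (hζ : IsPrimitiveRoot ζ (M * p ^ n)) {ι : Type*} (s : Finset ι)
    {w g : ι → K} (hw : ∀ i, w i ^ M = 1) (hg : ∀ i, g i ^ p ^ n = 1)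
    (h : ∑ i ∈ s, w i * g i = 0) {h₁ h₂ : K} (hh₁ : h₁ ^ p ^ n = 1) (hh₂ : h₂ ^ p ^ n = 1)
    (hpow : h₁ ^ p = h₂ ^ p) :
    ∑ i ∈ s with g i = h₁, w i = ∑ i ∈ s with g i = h₂, w i := by
  have hq : p ^ n ≠ 0 := pow_ne_zero n hp.ne_zero
  have ne_zero {z : K} (hz : z ^ p ^ n = 1) : z ≠ 0 := by
    rintro rfl
    exact zero_ne_one ((zero_pow hq).symm.trans hz)
  refine mul_left_cancel₀ (Nat.cast_ne_zero.2 hq) ?_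
  rw [natCast_mul_sum_filter_eq s w hg (ne_zero hh₁) hh₁,
    natCast_mul_sum_filter_eq s w hg (ne_zero hh₂) hh₂]
  refine Finset.sum_congr rfl fun t _ => ?_
  by_cases ht : p ∣ t
  · obtain ⟨r, rfl⟩ := ht
    rw [pow_mul h₁, pow_mul h₂, hpow]
  · simp only [sum_mul_pow_eq_zero_of_not_dvd hp hpM hζ s hw hg h ht, zero_mul]

theorem exists_mul_eq_of_pow_mul_eq_one {G : Type*} [CommMonoid G] {m n : ℕ} (hmn : m.Coprime n)
    {z : G} (hz : z ^ (m * n) = 1) : ∃ z₁ z₂ : G, z₁ ^ m = 1 ∧ z₂ ^ n = 1 ∧ z₁ * z₂ = z := by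
  obtain ⟨e₁, he₁m, he₁n⟩ := Nat.chineseRemainder hmn 1 0
  obtain ⟨e₂, he₂m, he₂n⟩ := Nat.chineseRemainder hmn 0 1
  obtain ⟨d₁, rfl⟩ := Nat.modEq_zero_iff_dvd.1 he₁n
  obtain ⟨d₂, rfl⟩ := Nat.modEq_zero_iff_dvd.1 he₂m
  have hsum : n * d₁ + m * d₂ ≡ 1 [MOD m * n] :=
    (Nat.modEq_and_modEq_iff_modEq_mul hmn).1
      ⟨by simpa using he₁m.add he₂m, by simpa using he₁n.add he₂n⟩
  refine ⟨z ^ (n * d₁), z ^ (m * d₂), ?_, ?_, ?_⟩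
  · rw [← pow_mul, mul_right_comm, mul_comm n, pow_mul, hz, one_pow]
  · rw [← pow_mul, mul_right_comm, pow_mul, hz, one_pow]
  · rw [← pow_add, pow_eq_pow_of_modEq hsum hz, pow_one]

theorem pow_eq_one_and_pow_eq_one_of_mul_pow_eq_one {G : Type*} [CommMonoid G] {m n r : ℕ}
    (hmn : m.Coprime n) {z₁ z₂ : G} (hz₁ : z₁ ^ m = 1) (hz₂ : z₂ ^ n = 1)
    (h : (z₁ * z₂) ^ r = 1) : z₁ ^ r = 1 ∧ z₂ ^ r = 1 := by
  have hz₁r : z₁ ^ r = 1 := by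
    refine (pow_eq_one_iff_of_coprime hmn).1 ⟨?_, ?_⟩
    · rw [pow_right_comm, hz₁, one_pow]
    · calc (z₁ ^ r) ^ n = ((z₁ * z₂) ^ r) ^ n := by
            rw [mul_pow, mul_pow, pow_right_comm z₂, hz₂, one_pow, mul_one]
        _ = 1 := by rw [h, one_pow]
  exact ⟨hz₁r, by rwa [mul_pow, hz₁r, one_mul] at h⟩

end RootsOfUnity

section EqOrInv

variable {G : Type*} [InvolutiveInv G] {g h k : G}

/-- `g` and `h` agree up to inversion, i.e. they index the same term of a relation that is
invariant under `z ↦ z⁻¹`. -/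
def EqOrInv (g h : G) : Prop := h = g ∨ h = g⁻¹

namespace EqOrInv

theorem symm (hgh : EqOrInv g h) : EqOrInv h g := by
  rcases hgh with rfl | rfl
  exacts [Or.inl rfl, Or.inr (inv_inv g).symm]

theorem trans (hgh : EqOrInv g h) (hhk : EqOrInv h k) : EqOrInv g k := by
  rcases hgh with rfl | rfl <;> rcases hhk with rfl | rfl
  exacts [Or.inl rfl, Or.inr rfl, Or.inr rfl, Or.inl (inv_inv g)]

end EqOrInv

end EqOrInv

section RelationCoefficients

variable {K : Type*} [Field K] [DecidableEq K] {X A Y U P V Q h : K}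

/-- The coefficient of `h` when `U * P + (U * P)⁻¹` is read as the formal combination
`P • [U] + P⁻¹ • [U⁻¹]`. -/
def pairCoeff (U P h : K) : K := (if U = h then P else 0) + if U⁻¹ = h then P⁻¹ else 0

/-- The coefficient of `h` when the relation
`(X * A - (X * A)⁻¹) * Y - (U * P + (U * P)⁻¹) - (V * Q + (V * Q)⁻¹) = 0` is read as a formal
combination of `X`, `U`, `V` and their inverses; in the application these are the `p`-primary
parts of the roots of unity involved. -/
def relCoeff (X A Y U P V Q h : K) : K :=
  (if X = h then A * Y else 0) - (if X⁻¹ = h then A⁻¹ * Y else 0)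
    - pairCoeff U P h - pairCoeff V Q h

theorem pairCoeff_eq_zero (hU : ¬EqOrInv U h) : pairCoeff U P h = 0 := by
  rw [EqOrInv, not_or] at hU
  rw [pairCoeff, if_neg (Ne.symm hU.1), if_neg (Ne.symm hU.2), add_zero]

theorem exists_pairCoeff_eq (hU : EqOrInv U h) (hh : h⁻¹ ≠ h) :
    ∃ P', EqOrInv P P' ∧ EqOrInv (U * P) (h * P') ∧
      pairCoeff U P h = P' ∧ pairCoeff U P h⁻¹ = P'⁻¹ := by
  rcases hU with rfl | rfl
  · exact ⟨P, Or.inl rfl, Or.inl rfl, by simp [pairCoeff, hh], by simp [pairCoeff, hh.symm]⟩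
  · rw [inv_inv] at hh
    exact ⟨P⁻¹, Or.inr rfl, Or.inr (mul_inv U P).symm, by simp [pairCoeff, hh],
      by simp [pairCoeff, hh.symm]⟩

theorem relCoeff_swap (X A Y U P V Q h : K) :
    relCoeff X A Y U P V Q h = relCoeff X A Y V Q U P h :=
  sub_right_comm _ _ _

theorem relCoeff_self (hX : X⁻¹ ≠ X) :
    relCoeff X A Y U P V Q X = A * Y - pairCoeff U P X - pairCoeff V Q X := by
  rw [relCoeff, if_pos rfl, if_neg hX, sub_zero]

theorem relCoeff_inv_self (hX : X⁻¹ ≠ X) :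
    relCoeff X A Y U P V Q X⁻¹ = -(A⁻¹ * Y) - pairCoeff U P X⁻¹ - pairCoeff V Q X⁻¹ := by
  rw [relCoeff, if_neg hX.symm, if_pos rfl, zero_sub]

theorem relCoeff_of_not_eqOrInv (hX : ¬EqOrInv X h) :
    relCoeff X A Y U P V Q h = -pairCoeff U P h - pairCoeff V Q h := by
  rw [EqOrInv, not_or] at hX
  rw [relCoeff, if_neg (Ne.symm hX.1), if_neg (Ne.symm hX.2), sub_zero, zero_sub]

theorem eqOrInv_or_eqOrInv_of_relCoeff_ne_zero (hX : ¬EqOrInv X h)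
    (hc : relCoeff X A Y U P V Q h ≠ 0) : EqOrInv U h ∨ EqOrInv V h := by
  contrapose! hc
  rw [relCoeff_of_not_eqOrInv hX, pairCoeff_eq_zero hc.1, pairCoeff_eq_zero hc.2, neg_zero,
    sub_zero]

theorem eqOrInv_pair_of_relCoeff_ne_zero {h₁ h₂ : K} (hX₁ : ¬EqOrInv X h₁) (hX₂ : ¬EqOrInv X h₂)
    (h₁₂ : ¬EqOrInv h₁ h₂) (hc₁ : relCoeff X A Y U P V Q h₁ ≠ 0)
    (hc₂ : relCoeff X A Y U P V Q h₂ ≠ 0) :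
    EqOrInv U h₁ ∧ EqOrInv V h₂ ∨ EqOrInv V h₁ ∧ EqOrInv U h₂ := by
  have not_both {W : K} (hW₁ : EqOrInv W h₁) (hW₂ : EqOrInv W h₂) : False :=
    h₁₂ (hW₁.symm.trans hW₂)
  rcases eqOrInv_or_eqOrInv_of_relCoeff_ne_zero hX₁ hc₁ with hU₁ | hV₁ <;>
    rcases eqOrInv_or_eqOrInv_of_relCoeff_ne_zero hX₂ hc₂ with hU₂ | hV₂
  exacts [(not_both hU₁ hU₂).elim, Or.inl ⟨hU₁, hV₂⟩, Or.inr ⟨hV₁, hU₂⟩, (not_both hV₁ hV₂).elim]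

theorem relCoeff_eq_zero_of_pairwise_not_eqOrInv {h₁ h₂ h₃ : K} (hX₁ : ¬EqOrInv X h₁)
    (hX₂ : ¬EqOrInv X h₂) (hX₃ : ¬EqOrInv X h₃) (h₁₂ : ¬EqOrInv h₁ h₂) (h₁₃ : ¬EqOrInv h₁ h₃)
    (h₂₃ : ¬EqOrInv h₂ h₃) (hc₁ : relCoeff X A Y U P V Q h₁ ≠ 0)
    (hc₂ : relCoeff X A Y U P V Q h₂ ≠ 0) : relCoeff X A Y U P V Q h₃ = 0 := by
  by_contra hc₃
  rcases eqOrInv_pair_of_relCoeff_ne_zero hX₁ hX₂ h₁₂ hc₁ hc₂ with ⟨hU, hV⟩ | ⟨hV, hU⟩ <;>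
    rcases eqOrInv_or_eqOrInv_of_relCoeff_ne_zero hX₃ hc₃ with hU₃ | hV₃
  exacts [h₁₃ (hU.symm.trans hU₃), h₂₃ (hV.symm.trans hV₃), h₂₃ (hU.symm.trans hU₃),
    h₁₃ (hV.symm.trans hV₃)]

theorem not_eqOrInv_of_relCoeff_ne_zero {h₁ h₂ : K} (hX₁ : ¬EqOrInv X h₁) (hX₂ : ¬EqOrInv X h₂)
    (h₁₂ : ¬EqOrInv h₁ h₂) (hc₁ : relCoeff X A Y U P V Q h₁ ≠ 0)
    (hc₂ : relCoeff X A Y U P V Q h₂ ≠ 0) : ¬EqOrInv U X ∧ ¬EqOrInv V X := by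
  rcases eqOrInv_pair_of_relCoeff_ne_zero hX₁ hX₂ h₁₂ hc₁ hc₂ with ⟨hU, hV⟩ | ⟨hV, hU⟩
  exacts [⟨fun h => hX₁ (h.symm.trans hU), fun h => hX₂ (h.symm.trans hV)⟩,
    ⟨fun h => hX₂ (h.symm.trans hU), fun h => hX₁ (h.symm.trans hV)⟩]

theorem relCoeff_self_of_not_eqOrInv (hX : X⁻¹ ≠ X) (hU : ¬EqOrInv U X) (hV : ¬EqOrInv V X) :
    relCoeff X A Y U P V Q X = A * Y := by
  rw [relCoeff_self hX, pairCoeff_eq_zero hU, pairCoeff_eq_zero hV, sub_zero, sub_zero]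

theorem sq_eq_neg_one_of_relCoeff_inv_eq (hX : X⁻¹ ≠ X) (hA : A ≠ 0) (hY : Y ≠ 0)
    (hU : ¬EqOrInv U X) (hV : ¬EqOrInv V X)
    (hc : relCoeff X A Y U P V Q X⁻¹ = relCoeff X A Y U P V Q X) : A ^ 2 = -1 := by
  have not_inv {W : K} (hW : ¬EqOrInv W X) : ¬EqOrInv W X⁻¹ :=
    fun h => hW (h.trans (.inr (inv_inv X).symm))
  rw [relCoeff_self_of_not_eqOrInv hX hU hV, relCoeff_inv_self hX, pairCoeff_eq_zero (not_inv hU),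
    pairCoeff_eq_zero (not_inv hV), sub_zero, sub_zero, ← neg_mul] at hc
  have : -A⁻¹ = A := mul_right_cancel₀ hY hc
  calc A ^ 2 = A * -A⁻¹ := by rw [this, sq]
    _ = -1 := by rw [mul_neg, mul_inv_cancel₀ hA]

theorem exists_mul_eq_neg_of_relCoeff_eq (hX : X⁻¹ ≠ X) {h₁ h₂ : K} (hX₁ : ¬EqOrInv X h₁)
    (hX₂ : ¬EqOrInv X h₂) (h₁₂ : ¬EqOrInv h₁ h₂) (hh₁ : h₁⁻¹ ≠ h₁)
    (hc : relCoeff X A Y U P V Q X ≠ 0)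
    (hc₁ : relCoeff X A Y U P V Q h₁ = relCoeff X A Y U P V Q X)
    (hc₂ : relCoeff X A Y U P V Q h₂ = relCoeff X A Y U P V Q X) :
    ∃ t, (EqOrInv P t ∨ EqOrInv Q t) ∧ A * Y = -t := by
  have ne₁ := hc₁.trans_ne hc
  have ne₂ := hc₂.trans_ne hc
  obtain ⟨hUX, hVX⟩ := not_eqOrInv_of_relCoeff_ne_zero hX₁ hX₂ h₁₂ ne₁ ne₂
  rw [relCoeff_self_of_not_eqOrInv hX hUX hVX, relCoeff_of_not_eqOrInv hX₁] at hc₁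
  rcases eqOrInv_pair_of_relCoeff_ne_zero hX₁ hX₂ h₁₂ ne₁ ne₂ with ⟨hU, hV⟩ | ⟨hV, hU⟩
  · obtain ⟨P', hP', -, hPh, -⟩ := exists_pairCoeff_eq (P := P) hU hh₁
    rw [hPh, pairCoeff_eq_zero fun h => h₁₂ (h.symm.trans hV), sub_zero] at hc₁
    exact ⟨P', Or.inl hP', hc₁.symm⟩
  · obtain ⟨Q', hQ', -, hQh, -⟩ := exists_pairCoeff_eq (P := Q) hV hh₁
    rw [hQh, pairCoeff_eq_zero fun h => h₁₂ (h.symm.trans hU), neg_zero, zero_sub] at hc₁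
    exact ⟨Q', Or.inr hQ', hc₁.symm⟩

theorem exists_two_mul_eq_of_eqOrInv_one [NeZero (2 : K)] (hX : X⁻¹ ≠ X) (hA : A ^ 2 = 1)
    (hY : Y ≠ 0) (hU : EqOrInv U 1)
    (hc : relCoeff X A Y U P V Q X⁻¹ = relCoeff X A Y U P V Q X) :
    ∃ t, EqOrInv Q t ∧ 2 * (A * Y) = t - t⁻¹ := by
  have hX1 : ¬EqOrInv (1 : K) X := fun h => hX (by rcases h with rfl | rfl <;> simp)
  have hUX : ¬EqOrInv U X := fun h => hX1 (hU.symm.trans h)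
  have hAinv : A⁻¹ = A := inv_eq_of_mul_eq_one_right (by rw [← sq, hA])
  have hA0 : A ≠ 0 := by
    rintro rfl
    simp at hA
  have hV : EqOrInv V X := by
    by_contra hV
    have h := sq_eq_neg_one_of_relCoeff_inv_eq hX hA0 hY hUX hV hc
    exact two_ne_zero (α := K) (by linear_combination h - hA)
  obtain ⟨Q', hQ', -, hQX, hQX'⟩ := exists_pairCoeff_eq (P := Q) hV hX
  rw [relCoeff_self hX, relCoeff_inv_self hX, hQX, hQX', pairCoeff_eq_zero hUX,
    pairCoeff_eq_zero fun h => hUX (h.trans (.inr (by simp))), hAinv] at hc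
  exact ⟨Q', hQ', by linear_combination -hc⟩

theorem exists_two_mul_eq_of_relCoeff_one_eq [NeZero (2 : K)] (hX : X⁻¹ ≠ X) (hA : A ^ 2 = 1)
    (hY : Y ≠ 0) (hc : relCoeff X A Y U P V Q X ≠ 0)
    (hc₁ : relCoeff X A Y U P V Q 1 = relCoeff X A Y U P V Q X)
    (hc' : relCoeff X A Y U P V Q X⁻¹ = relCoeff X A Y U P V Q X) :
    ∃ t, (EqOrInv P t ∨ EqOrInv Q t) ∧ 2 * (A * Y) = t - t⁻¹ := by
  have hX1 : ¬EqOrInv X 1 := fun h => hX (by rcases h.symm with rfl | rfl <;> simp)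
  rcases eqOrInv_or_eqOrInv_of_relCoeff_ne_zero hX1 (hc₁.trans_ne hc) with hU | hV
  · obtain ⟨t, ht, h⟩ := exists_two_mul_eq_of_eqOrInv_one hX hA hY hU hc'
    exact ⟨t, Or.inr ht, h⟩
  · rw [relCoeff_swap, relCoeff_swap X A Y U P V Q X] at hc'
    obtain ⟨t, ht, h⟩ := exists_two_mul_eq_of_eqOrInv_one hX hA hY hV hc'
    exact ⟨t, Or.inl ht, h⟩

/-- The relation `z + z⁻¹ + … = u + u⁻¹ + v + v⁻¹` splits into a shorter one: `z` is a sum of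
elements of the orbits of `u` and `v` under inversion, or lies in one of these orbits. -/
def HasShortRelation (z u v : K) : Prop :=
  (∃ u' v', EqOrInv u u' ∧ EqOrInv v v' ∧ z = u' + v') ∨ EqOrInv u z ∨ EqOrInv v z

theorem hasShortRelation_of_relCoeff_eq_zero (hX : X⁻¹ ≠ X) (hA : A ≠ 0) (hY : Y ≠ 0)
    (hc : relCoeff X A Y U P V Q X = 0) : HasShortRelation (X * A * Y) (U * P) (V * Q) := by
  rw [relCoeff_self hX] at hc
  by_cases hU : EqOrInv U X <;> by_cases hV : EqOrInv V X
  · obtain ⟨P', -, hUP, hPX, -⟩ := exists_pairCoeff_eq (P := P) hU hX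
    obtain ⟨Q', -, hVQ, hQX, -⟩ := exists_pairCoeff_eq (P := Q) hV hX
    rw [hPX, hQX] at hc
    exact Or.inl ⟨X * P', X * Q', hUP, hVQ, by linear_combination X * hc⟩
  · obtain ⟨P', -, hUP, hPX, -⟩ := exists_pairCoeff_eq (P := P) hU hX
    rw [hPX, pairCoeff_eq_zero hV, sub_zero, sub_eq_zero] at hc
    exact Or.inr (Or.inl (by rwa [mul_assoc, hc]))
  · obtain ⟨Q', -, hVQ, hQX, -⟩ := exists_pairCoeff_eq (P := Q) hV hX
    rw [hQX, pairCoeff_eq_zero hU, sub_zero, sub_eq_zero] at hc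
    exact Or.inr (Or.inr (by rwa [mul_assoc, hc]))
  · rw [pairCoeff_eq_zero hU, pairCoeff_eq_zero hV, sub_zero, sub_zero] at hc
    exact absurd hc (mul_ne_zero hA hY)

theorem relCoeff_eq_of_pow_eq [CharZero K] {p n M : ℕ} (hp : p.Prime) (hpM : ¬p ∣ M)
    (hM : Even M) {ζ : K} (hζ : IsPrimitiveRoot ζ (M * p ^ (n + 1))) {y : K}
    (hX : X ^ p ^ (n + 1) = 1) (hU : U ^ p ^ (n + 1) = 1) (hV : V ^ p ^ (n + 1) = 1)
    (hA : A ^ M = 1) (hy : y ^ M = 1) (hP : P ^ M = 1) (hQ : Q ^ M = 1)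
    (h : (X * A - (X * A)⁻¹) * (y - y⁻¹) = U * P + (U * P)⁻¹ + (V * Q + (V * Q)⁻¹))
    {h₁ h₂ : K} (hh₂ : h₂ ^ p ^ (n + 1) = 1) (hpow : h₁ ^ p = h₂ ^ p) :
    relCoeff X A (y - y⁻¹) U P V Q h₁ = relCoeff X A (y - y⁻¹) U P V Q h₂ := by
  have hh₁ : h₁ ^ p ^ (n + 1) = 1 := by rw [pow_succ', pow_mul, hpow, ← pow_mul, ← pow_succ', hh₂]
  let w : Fin 8 → K := ![A * y, -(A * y⁻¹), -(A⁻¹ * y), A⁻¹ * y⁻¹, -P, -P⁻¹, -Q, -Q⁻¹]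
  let g : Fin 8 → K := ![X, X, X⁻¹, X⁻¹, U, U⁻¹, V, V⁻¹]
  have hw : ∀ i, w i ^ M = 1 := fun i => by
    fin_cases i <;> simp [w, mul_pow, hM.neg_pow, hA, hy, hP, hQ]
  have hg : ∀ i, g i ^ p ^ (n + 1) = 1 := fun i => by fin_cases i <;> simp [g, hX, hU, hV]
  have hwg : ∑ i, w i * g i = 0 := by
    rw [← sub_eq_zero.2 h]
    simp only [Fin.sum_univ_eight, w, g, mul_inv, Matrix.cons_val]
    ring
  have relCoeff_eq (z : K) : ∑ i with g i = z, w i = relCoeff X A (y - y⁻¹) U P V Q z := by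
    have expand : ∑ i with g i = z, w i =
        (if X = z then A * y else 0) + (if X = z then -(A * y⁻¹) else 0)
          + (if X⁻¹ = z then -(A⁻¹ * y) else 0) + (if X⁻¹ = z then A⁻¹ * y⁻¹ else 0)
          + (if U = z then -P else 0) + (if U⁻¹ = z then -P⁻¹ else 0)
          + (if V = z then -Q else 0) + (if V⁻¹ = z then -Q⁻¹ else 0) := by
      rw [Finset.sum_filter, Fin.sum_univ_eight]
      rfl
    rw [expand, relCoeff, pairCoeff, pairCoeff]
    split_ifs <;> ring
  rw [← relCoeff_eq, ← relCoeff_eq]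
  exact sum_filter_eq_of_pow_eq hp hpM hζ Finset.univ hw hg hwg hh₁ hh₂ hpow

end RelationCoefficients

section PrimaryCosets

variable {K : Type*} [Field K] {X A Y U P V Q ω : K} {p : ℕ}

theorem mul_pow_pow_eq (hω : IsPrimitiveRoot ω p) (X : K) (k : ℕ) : (X * ω ^ k) ^ p = X ^ p := by
  rw [mul_pow, pow_right_comm, hω.pow_eq_one, one_pow, mul_one]

theorem mul_pow_ne_inv_mul_pow (hω : IsPrimitiveRoot ω p) (hp : p ≠ 0) (hX0 : X ≠ 0)
    (hX : X ^ (2 * p) ≠ 1) (j k : ℕ) : X * ω ^ k ≠ (X * ω ^ j)⁻¹ := by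
  refine fun h => hX ?_
  calc X ^ (2 * p) = (X * ω ^ j) ^ p * (X * ω ^ k) ^ p := by
        rw [mul_pow_pow_eq hω, mul_pow_pow_eq hω, two_mul, pow_add]
    _ = 1 := by
        rw [h, ← mul_pow, mul_inv_cancel₀ (mul_ne_zero hX0 (pow_ne_zero j (hω.ne_zero hp))),
          one_pow]

theorem not_eqOrInv_mul_pow (hω : IsPrimitiveRoot ω p) (hX0 : X ≠ 0) (hX : X ^ (2 * p) ≠ 1)
    {j k : ℕ} (hj : j < p) (hk : k < p) (hjk : j ≠ k) : ¬EqOrInv (X * ω ^ j) (X * ω ^ k) := by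
  rintro (h | h)
  · exact hjk (hω.pow_inj hk hj (mul_left_cancel₀ hX0 h)).symm
  · exact mul_pow_ne_inv_mul_pow hω (by omega) hX0 hX j k h

theorem not_eqOrInv_self_mul_pow (hω : IsPrimitiveRoot ω p) (hX0 : X ≠ 0) (hX : X ^ (2 * p) ≠ 1)
    {k : ℕ} (hk0 : 0 ≠ k) (hk : k < p) : ¬EqOrInv X (X * ω ^ k) := by
  simpa only [pow_zero, mul_one] using not_eqOrInv_mul_pow hω hX0 hX (by omega) hk hk0

variable [DecidableEq K]

theorem relCoeff_self_eq_zero_of_pow_ne_one (hp : 5 ≤ p) (hω : IsPrimitiveRoot ω p)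
    (hX0 : X ≠ 0) (hX : X ^ (2 * p) ≠ 1)
    (hc : ∀ h, h ^ p = X ^ p → relCoeff X A Y U P V Q h = relCoeff X A Y U P V Q X) :
    relCoeff X A Y U P V Q X = 0 := by
  have hself {k : ℕ} (hk0 : 0 ≠ k) (hk : k < p) := not_eqOrInv_self_mul_pow hω hX0 hX hk0 hk
  have hsep {j k : ℕ} (hj : j < p) (hk : k < p) (hjk : j ≠ k) :=
    not_eqOrInv_mul_pow hω hX0 hX hj hk hjk
  have hcoset (j : ℕ) := hc _ (mul_pow_pow_eq hω X j)
  by_contra hne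
  refine hne ?_
  rw [← hcoset 3]
  exact relCoeff_eq_zero_of_pairwise_not_eqOrInv (hself (k := 1) (by omega) (by omega))
    (hself (k := 2) (by omega) (by omega)) (hself (by omega) (by omega))
    (hsep (by omega) (by omega) (by omega)) (hsep (by omega) (by omega) (by omega))
    (hsep (by omega) (by omega) (by omega)) ((hcoset 1).trans_ne hne) ((hcoset 2).trans_ne hne)

theorem relCoeff_self_eq_zero_of_isPrimitiveRoot (hp : 5 ≤ p) (hX : IsPrimitiveRoot X p)
    (hA : A ≠ 0) (hA' : A ^ 2 ≠ -1) (hY : Y ≠ 0)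
    (hc : ∀ h, h ^ p = X ^ p → relCoeff X A Y U P V Q h = relCoeff X A Y U P V Q X) :
    relCoeff X A Y U P V Q X = 0 := by
  have hX0 : X ≠ 0 := hX.ne_zero (by omega)
  have pow_ne {k : ℕ} (hk0 : k ≠ 0) (hk : k < p) : X ^ k ≠ 1 := hX.pow_ne_one_of_pos_of_lt hk0 hk
  have hXinv : X⁻¹ ≠ X := fun h => pow_ne two_ne_zero (by omega)
    (by rw [sq, mul_eq_one_iff_eq_inv₀ hX0, h])
  have h₁ : ¬EqOrInv X 1 := by
    rintro (h | h)
    · exact pow_ne one_ne_zero (by omega) (by rw [pow_one, h])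
    · exact pow_ne one_ne_zero (by omega) (by rw [pow_one, ← inv_inv X, ← h, inv_one])
  have h₂ : ¬EqOrInv X (X ^ 2) := by
    rintro (h | h)
    · exact pow_ne one_ne_zero (by omega) (mul_left_cancel₀ hX0 (by rw [pow_one, mul_one, ← sq, h]))
    · exact pow_ne three_ne_zero (by omega) (by rw [pow_succ, h, inv_mul_cancel₀ hX0])
  have h₁₂ : ¬EqOrInv 1 (X ^ 2) := by
    rintro (h | h)
    · exact pow_ne two_ne_zero (by omega) h
    · exact pow_ne two_ne_zero (by omega) (by rw [h, inv_one])
  have hXp : X ^ p = 1 := hX.pow_eq_one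
  by_contra hne
  obtain ⟨hU, hV⟩ := not_eqOrInv_of_relCoeff_ne_zero h₁ h₂ h₁₂
    ((hc 1 (by rw [one_pow, hXp])).trans_ne hne)
    ((hc (X ^ 2) (by rw [pow_right_comm, hXp, one_pow])).trans_ne hne)
  exact hA' (sq_eq_neg_one_of_relCoeff_inv_eq hXinv hA hY hU hV
    (hc X⁻¹ (by rw [inv_pow, hXp, inv_one])))

theorem exists_mul_eq_of_relCoeff_self_ne_zero [NeZero (2 : K)] (hω : IsPrimitiveRoot ω 3)
    (hX0 : X ≠ 0) (hXinv : X⁻¹ ≠ X) (hX : X ^ 6 = 1 → X ^ 3 = 1) (hA : A ^ 2 = 1) (hY : Y ≠ 0)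
    (hc : ∀ h, h ^ 3 = X ^ 3 → relCoeff X A Y U P V Q h = relCoeff X A Y U P V Q X)
    (hne : relCoeff X A Y U P V Q X ≠ 0) :
    ∃ t, (EqOrInv P t ∨ EqOrInv Q t) ∧ (A * Y = -t ∨ 2 * (A * Y) = t - t⁻¹) := by
  by_cases h6 : X ^ 6 = 1
  · have hX3 := hX h6
    obtain ⟨t, ht, h⟩ := exists_two_mul_eq_of_relCoeff_one_eq hXinv hA hY hne
      (hc 1 (by rw [one_pow, hX3])) (hc X⁻¹ (by rw [inv_pow, hX3, inv_one]))
    exact ⟨t, ht, Or.inr h⟩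
  · have hself {k : ℕ} (hk0 : 0 ≠ k) (hk : k < 3) := not_eqOrInv_self_mul_pow hω hX0 h6 hk0 hk
    have hcoset (j : ℕ) := hc _ (mul_pow_pow_eq hω X j)
    obtain ⟨t, ht, h⟩ := exists_mul_eq_neg_of_relCoeff_eq hXinv
      (hself (by omega) (by omega)) (hself (by omega) (by omega))
      (not_eqOrInv_mul_pow hω hX0 h6 (by omega) (by omega) (by omega))
      (mul_pow_ne_inv_mul_pow hω three_ne_zero hX0 h6 1 1).symm hne (hcoset 1) (hcoset 2)
    exact ⟨t, ht, Or.inl h⟩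

end PrimaryCosets

section Kronecker

/-- Kronecker's theorem applies: every conjugate of `z` is the midpoint of two roots of unity. -/
theorem exists_pow_eq_one_of_two_mul_eq_add {L : Type*} [Field L] [CharZero L] {m : ℕ} (hm : m ≠ 0)
    {z s t : L} (hz : IsIntegral ℤ z) (hz0 : z ≠ 0) (hs : s ^ m = 1) (ht : t ^ m = 1)
    (h : 2 * z = s + t) : ∃ n, 0 < n ∧ z ^ n = 1 := by
  have isIntegral {w : L} (hw : w ^ m = 1) : IsIntegral ℚ w :=
    .of_pow (Nat.pos_of_ne_zero hm) (hw ▸ isIntegral_one)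
  let F := IntermediateField.adjoin ℚ {s, t}
  have : FiniteDimensional ℚ F :=
    IntermediateField.finiteDimensional_adjoin_pair (isIntegral hs) (isIntegral ht)
  have : NumberField F := ⟨⟩
  let s' : F := ⟨s, IntermediateField.mem_adjoin_pair_left ℚ s t⟩
  let t' : F := ⟨t, IntermediateField.mem_adjoin_pair_right ℚ s t⟩
  let z' : F := (s' + t') / 2
  have hz' : algebraMap F L z' = z := by
    rw [map_div₀, map_add, map_ofNat, div_eq_iff two_ne_zero, mul_comm, h]
    rfl
  have norm_le (φ : F →+* ℂ) : ‖φ z'‖ ≤ 1 := by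
    have norm_eq {w : F} (hw : w ^ m = 1) : ‖φ w‖ = 1 :=
      Complex.norm_eq_one_of_pow_eq_one (by rw [← map_pow, hw, map_one]) hm
    calc ‖φ z'‖ = ‖φ s' + φ t'‖ / 2 := by
          rw [map_div₀, map_add, map_ofNat, norm_div, Complex.norm_ofNat]
      _ ≤ (‖φ s'‖ + ‖φ t'‖) / 2 := by gcongr; exact norm_add_le _ _
      _ = 1 := by rw [norm_eq (Subtype.ext hs), norm_eq (Subtype.ext ht)]; norm_num
  rw [← hz'] at hz hz0 ⊢
  have hinj := FaithfulSMul.algebraMap_injective F L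
  obtain ⟨n, hn, hzn⟩ := NumberField.Embeddings.pow_eq_one_of_norm_le_one F ℂ
    ((map_ne_zero _).1 hz0) ((isIntegral_algebraMap_iff hinj).1 hz) norm_le
  exact ⟨n, hn, by rw [← map_pow, hzn, map_one]⟩

theorem isPrimitiveRoot_sq_of_norm_sub_inv_eq_one {y : ℂ} (hy : ‖y‖ = 1) (h : ‖y - y⁻¹‖ = 1) :
    IsPrimitiveRoot (y ^ 2) 6 := by
  have hy0 : y ≠ 0 := norm_ne_zero_iff.1 (by rw [hy]; exact one_ne_zero)
  have hconj : (starRingEnd ℂ) (y - y⁻¹) = y⁻¹ - y := by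
    rw [map_sub, map_inv₀, ← Complex.inv_eq_conj hy, inv_inv]
  have hmul : (y - y⁻¹) * (y⁻¹ - y) = 1 := by
    rw [← hconj, Complex.mul_conj, Complex.normSq_eq_norm_sq, h]
    norm_num
  rw [← Polynomial.isRoot_cyclotomic_iff_charZero (by norm_num), Polynomial.cyclotomic_six]
  field_simp at hmul
  simp only [Polynomial.IsRoot.def, Polynomial.eval_add, Polynomial.eval_sub, Polynomial.eval_pow,
    Polynomial.eval_X, Polynomial.eval_one]
  linear_combination -hmul

theorem three_dvd_of_norm_sub_inv_eq_one {b : ℕ} {y : ℂ} (hy : y ^ (2 * b) = 1)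
    (h : ‖y - y⁻¹‖ = 1) : 3 ∣ b := by
  obtain rfl | hb := eq_or_ne b 0
  · exact dvd_zero 3
  have hy1 : ‖y‖ = 1 := Complex.norm_eq_one_of_pow_eq_one hy (by positivity)
  have h6 : 6 ∣ b := (isPrimitiveRoot_sq_of_norm_sub_inv_eq_one hy1 h).dvd_of_pow_eq_one b
    (by rw [← pow_mul, hy])
  exact (by norm_num : 3 ∣ 6).trans h6

theorem norm_eq_one_of_mul_eq_neg_or_two_mul_eq_sub {M : ℕ} (hM : M ≠ 0) (hM' : Even M)
    {A t Y : ℂ} (hA : A ^ M = 1) (ht : t ^ M = 1) (hY0 : Y ≠ 0) (hY : IsIntegral ℤ Y)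
    (h : A * Y = -t ∨ 2 * (A * Y) = t - t⁻¹) : ‖Y‖ = 1 := by
  have norm_eq {z : ℂ} (hz : z ^ M = 1) : ‖z‖ = 1 := Complex.norm_eq_one_of_pow_eq_one hz hM
  suffices ‖A * Y‖ = 1 by rwa [norm_mul, norm_eq hA, one_mul] at this
  rcases h with h | h
  · rw [h, norm_neg, norm_eq ht]
  · have hA0 : A ≠ 0 := norm_ne_zero_iff.1 (by rw [norm_eq hA]; exact one_ne_zero)
    have hAint : IsIntegral ℤ A := .of_pow (Nat.pos_of_ne_zero hM) (hA ▸ isIntegral_one)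
    obtain ⟨n, hn, hAY⟩ := exists_pow_eq_one_of_two_mul_eq_add hM (hAint.mul hY)
      (mul_ne_zero hA0 hY0) ht (t := -t⁻¹) (by rw [hM'.neg_pow, inv_pow, ht, inv_one])
      (by rw [h, sub_eq_add_neg])
    exact Complex.norm_eq_one_of_pow_eq_one hAY hn.ne'

end Kronecker

section ShortRelation

theorem pow_eq_one_of_pow_two_mul_eq_one {G : Type*} [Monoid G] {p n : ℕ} (hp : Odd p) {X : G}
    (hX : X ^ p ^ n = 1) (h : X ^ (2 * p) = 1) : X ^ p = 1 := by
  refine (pow_eq_one_iff_of_coprime (Nat.coprime_two_left.2 (hp.pow (n := n)))).1 ⟨?_, ?_⟩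
  · rw [← pow_mul', h]
  · rw [pow_right_comm, hX, one_pow]

theorem relCoeff_self_eq_zero_of_five_le {K : Type*} [Field K] [DecidableEq K] {p n : ℕ}
    (hp : p.Prime) (hp5 : 5 ≤ p) {X A Y U P V Q ω : K} (hω : IsPrimitiveRoot ω p) (hX0 : X ≠ 0)
    (hX : X ^ p ^ n = 1) (hX1 : X ≠ 1) (hA : A ≠ 0) (hA' : A ^ 2 ≠ -1) (hY : Y ≠ 0)
    (hc : ∀ h, h ^ p = X ^ p → relCoeff X A Y U P V Q h = relCoeff X A Y U P V Q X) :
    relCoeff X A Y U P V Q X = 0 := by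
  by_cases h : X ^ (2 * p) = 1
  · have := Fact.mk hp
    have hXp := pow_eq_one_of_pow_two_mul_eq_one (hp.odd_of_ne_two (by omega)) hX h
    have hX' : IsPrimitiveRoot X p := orderOf_eq_prime hXp hX1 ▸ IsPrimitiveRoot.orderOf X
    exact relCoeff_self_eq_zero_of_isPrimitiveRoot hp5 hX' hA hA' hY hc
  · exact relCoeff_self_eq_zero_of_pow_ne_one hp5 hω hX0 h hc

theorem hasShortRelation_of_primary_decomposition {p n M b : ℕ} (hp : p.Prime) (hpM : ¬p ∣ M)
    (hM : Even M) {X A y U P V Q : ℂ} (hX : X ^ p ^ (n + 1) = 1) (hX1 : X ≠ 1)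
    (hU : U ^ p ^ (n + 1) = 1) (hV : V ^ p ^ (n + 1) = 1) (hA : A ^ M = 1) (hA' : A ^ 2 ≠ -1)
    (hy : y ^ M = 1) (hyb : y ^ (2 * b) = 1) (hy2 : y ^ 2 ≠ 1) (hP : P ^ M = 1) (hQ : Q ^ M = 1)
    (hpA : 5 ≤ p ∨ p = 3 ∧ A ^ 2 = 1 ∧ ¬3 ∣ b)
    (h : (X * A - (X * A)⁻¹) * (y - y⁻¹) = U * P + (U * P)⁻¹ + (V * Q + (V * Q)⁻¹)) :
    HasShortRelation (X * A * (y - y⁻¹)) (U * P) (V * Q) := by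
  have hM0 : M ≠ 0 := fun h => hpM (h ▸ dvd_zero p)
  have ne_zero {z : ℂ} {m : ℕ} (hm : m ≠ 0) (hz : z ^ m = 1) : z ≠ 0 := by
    rintro rfl
    exact zero_ne_one ((zero_pow hm).symm.trans hz)
  have hX0 : X ≠ 0 := ne_zero (pow_ne_zero _ hp.ne_zero) hX
  have hA0 : A ≠ 0 := ne_zero hM0 hA
  have hY : y - y⁻¹ ≠ 0 := fun hY => hy2 <| by
    rw [sq, mul_eq_one_iff_eq_inv₀ (ne_zero hM0 hy), ← sub_eq_zero, hY]
  have hp_odd : Odd p := hp.odd_of_ne_two (by omega)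
  have hXinv : X⁻¹ ≠ X := fun hXinv => hX1 <|
    (pow_eq_one_iff_of_coprime (Nat.coprime_two_left.2 hp_odd.pow)).1
      ⟨by rw [sq, mul_eq_one_iff_eq_inv₀ hX0, hXinv], hX⟩
  have hζ := Complex.isPrimitiveRoot_exp (M * p ^ (n + 1))
    (mul_ne_zero hM0 (pow_ne_zero _ hp.ne_zero))
  have hω := Complex.isPrimitiveRoot_exp p hp.ne_zero
  have hc (z : ℂ) (hz : z ^ p = X ^ p) :
      relCoeff X A (y - y⁻¹) U P V Q z = relCoeff X A (y - y⁻¹) U P V Q X :=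
    relCoeff_eq_of_pow_eq hp hpM hM hζ hX hU hV hA hy hP hQ h hX hz
  refine hasShortRelation_of_relCoeff_eq_zero hXinv hA0 hY ?_
  rcases hpA with hp5 | ⟨rfl, hA2, hb3⟩
  · exact relCoeff_self_eq_zero_of_five_le hp hp5 hω hX0 hX hX1 hA0 hA' hY hc
  · by_contra hne
    obtain ⟨t, ht, htY⟩ := exists_mul_eq_of_relCoeff_self_ne_zero hω hX0 hXinv
      (pow_eq_one_of_pow_two_mul_eq_one hp_odd hX) hA2 hY hc hne
    have htM : t ^ M = 1 := by
      rcases ht with (rfl | rfl) | (rfl | rfl) <;> simp only [inv_pow, hP, hQ, inv_one]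
    have isIntegral {z : ℂ} (hz : z ^ M = 1) : IsIntegral ℤ z :=
      .of_pow (Nat.pos_of_ne_zero hM0) (hz ▸ isIntegral_one)
    have hYint : IsIntegral ℤ (y - y⁻¹) :=
      (isIntegral hy).sub (isIntegral (by rw [inv_pow, hy, inv_one]))
    exact hb3 (three_dvd_of_norm_sub_inv_eq_one hyb
      (norm_eq_one_of_mul_eq_neg_or_two_mul_eq_sub hM0 hM hA htM hY hYint htY))

theorem exists_prime_dvd_and_five_le_or_eq_three_pow {m : ℕ} (hm : Odd m) (hm1 : m ≠ 1) :
    ∃ p, p.Prime ∧ p ∣ m ∧ (5 ≤ p ∨ p = 3 ∧ ∃ k, m = 3 ^ k) := by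
  by_cases h : ∀ {q : ℕ}, q.Prime → q ∣ m → q = 3
  · have hm3 := Nat.eq_prime_pow_of_unique_prime_dvd hm.pos.ne' h
    obtain ⟨q, hq, hqm⟩ := Nat.exists_prime_and_dvd hm1
    obtain rfl := h hq hqm
    exact ⟨3, hq, hqm, Or.inr ⟨rfl, _, hm3⟩⟩
  · push Not at h
    obtain ⟨q, hq, hqm, hq3⟩ := h
    have hq_odd := hm.of_dvd_nat hqm
    have hq4 : q ≠ 4 := by
      rintro rfl
      exact absurd hq_odd (by decide)
    have hq2 : q ≠ 2 := by
      rintro rfl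
      exact absurd hq_odd (by decide)
    have := hq.two_le
    exact ⟨q, hq, hqm, Or.inl (by omega)⟩

theorem sq_ne_neg_one_of_pow_two_mul_eq_one {a : ℕ} (ha : Odd a) {A : ℂ} (h : A ^ (2 * a) = 1) :
    A ^ 2 ≠ -1 := by
  intro hA
  rw [pow_mul, hA, ha.neg_one_pow] at h
  norm_num at h

theorem sq_eq_one_of_orderOf_mul_sq_eq_pow {G : Type*} [CommMonoid G] {p n k M : ℕ}
    (hpM : p.Coprime M) {X A : G} (hX : X ^ p ^ n = 1) (hA : A ^ M = 1)
    (h : orderOf ((X * A) ^ 2) = p ^ k) : A ^ 2 = 1 := by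
  have hXA : (X * A) ^ (2 * p ^ k) = 1 := by rw [pow_mul, ← h, pow_orderOf_eq_one]
  have hA2 := (pow_eq_one_and_pow_eq_one_of_mul_pow_eq_one (hpM.pow_left n) hX hA hXA).2
  exact (pow_eq_one_iff_of_coprime (hpM.pow_left k)).1
    ⟨by rw [← pow_mul, hA2], by rw [pow_right_comm, hA, one_pow]⟩

theorem hasShortRelation_of_prime_dvd_orderOf {a b N p : ℕ} (hab : a.Coprime b) (ha : Odd a)
    (hb : b ≠ 0) (hN : N ≠ 0) (hN' : Even N) {x y u v : ℂ} (hx : x ^ (2 * a) = 1)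
    (hy : y ^ (2 * b) = 1) (hy2 : y ^ 2 ≠ 1) (hu : u ^ N = 1) (hv : v ^ N = 1)
    (h : (x - x⁻¹) * (y - y⁻¹) = u + u⁻¹ + (v + v⁻¹)) (hp : p.Prime) (hpa : p ∣ a)
    (hpx : p ∣ orderOf (x ^ 2)) (hp35 : 5 ≤ p ∨ p = 3 ∧ ∃ k, orderOf (x ^ 2) = 3 ^ k) :
    HasShortRelation (x * (y - y⁻¹)) u v := by
  obtain ⟨e, M, hpM, hNM⟩ := Nat.exists_eq_pow_mul_and_not_dvd (n := N * (a * (2 * b)))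
    (by have := ha.pos; positivity) p hp.ne_one
  obtain ⟨n, rfl⟩ : ∃ n, e = n + 1 := Nat.exists_eq_succ_of_ne_zero <| by
    rintro rfl
    rw [pow_zero, one_mul] at hNM
    exact hpM (hNM ▸ (hpa.mul_right _).mul_left _)
  have hcop : p.Coprime M := hp.coprime_iff_not_dvd.2 hpM
  have hpb : p.Coprime (2 * b) := (ha.coprime_two_right.mul_right hab).coprime_dvd_left hpa
  have pow_eq_one {z : ℂ} {k : ℕ} (hk : k ∣ N * (a * (2 * b))) (hz : z ^ k = 1) :
      z ^ (p ^ (n + 1) * M) = 1 := by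
    obtain ⟨d, hd⟩ := hk
    rw [← hNM, hd, pow_mul, hz, one_pow]
  have split {z : ℂ} {k : ℕ} (hk : k ∣ N * (a * (2 * b))) (hz : z ^ k = 1) :
      ∃ z₁ z₂, z₁ ^ p ^ (n + 1) = 1 ∧ z₂ ^ M = 1 ∧ z₁ * z₂ = z :=
    exists_mul_eq_of_pow_mul_eq_one (hcop.pow_left _) (pow_eq_one hk hz)
  obtain ⟨X, A, hX, hA, rfl⟩ := split ⟨N * b, by ring⟩ hx
  obtain ⟨U, P, hU, hP, rfl⟩ := split (dvd_mul_right N _) hu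
  obtain ⟨V, Q, hV, hQ, rfl⟩ := split (dvd_mul_right N _) hv
  have hyM : y ^ M = 1 := (pow_eq_one_iff_of_coprime (hpb.pow_left (n + 1))).1
    ⟨by rw [← pow_mul', pow_eq_one (Dvd.intro_left (N * a) (by ring)) hy],
      by rw [pow_right_comm, hy, one_pow]⟩
  have hM : Even M := by
    have := hN'.mul_right (a * (2 * b))
    rw [hNM, Nat.even_mul, Nat.even_pow] at this
    exact this.resolve_left fun hpe => Nat.not_even_iff_odd.2 (ha.of_dvd_nat hpa) hpe.1
  have hX1 : X ≠ 1 := by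
    rintro rfl
    rw [one_mul] at hpx
    exact hpM (hpx.trans (orderOf_dvd_of_pow_eq_one (by rw [pow_right_comm, hA, one_pow])))
  have hA' : A ^ 2 ≠ -1 := sq_ne_neg_one_of_pow_two_mul_eq_one ha
    (pow_eq_one_and_pow_eq_one_of_mul_pow_eq_one (hcop.pow_left _) hX hA hx).2
  refine hasShortRelation_of_primary_decomposition hp hpM hM hX hX1 hU hV hA hA' hyM hy hy2 hP
    hQ (hp35.imp_right ?_) h
  rintro ⟨rfl, k, hk⟩
  exact ⟨rfl, sq_eq_one_of_orderOf_mul_sq_eq_pow hcop hX hA hk,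
    fun hb3 => hp.ne_one (Nat.eq_one_of_dvd_coprimes hab hpa hb3)⟩

theorem hasShortRelation_of_coprime {a b N : ℕ} (hab : a.Coprime b) (ha : Odd a) (hb : b ≠ 0)
    (hN : N ≠ 0) (hN' : Even N) {x y u v : ℂ} (hx : x ^ (2 * a) = 1) (hx2 : x ^ 2 ≠ 1)
    (hy : y ^ (2 * b) = 1) (hy2 : y ^ 2 ≠ 1) (hu : u ^ N = 1) (hv : v ^ N = 1)
    (h : (x - x⁻¹) * (y - y⁻¹) = u + u⁻¹ + (v + v⁻¹)) :
    HasShortRelation (x * (y - y⁻¹)) u v := by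
  have hxa : orderOf (x ^ 2) ∣ a := orderOf_dvd_of_pow_eq_one (by rw [← pow_mul, hx])
  obtain ⟨p, hp, hpx, hp35⟩ := exists_prime_dvd_and_five_le_or_eq_three_pow
    (ha.of_dvd_nat hxa) (by rwa [ne_eq, orderOf_eq_one_iff])
  exact hasShortRelation_of_prime_dvd_orderOf hab ha hb hN hN' hx hy hy2 hu hv h hp
    (hpx.trans hxa) hpx hp35

end ShortRelation

section Trigonometry

theorem circle_exp_sub_inv (θ : ℝ) :
    (Circle.exp θ : ℂ) - (Circle.exp θ : ℂ)⁻¹ = 2 * Real.sin θ * Complex.I := by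
  rw [← Circle.coe_inv, ← Circle.exp_neg, Circle.coe_exp, Circle.coe_exp, Complex.ofReal_sin,
    Complex.ofReal_neg, Complex.two_sin, mul_assoc, Complex.I_mul_I]
  ring

theorem circle_exp_add_inv (θ : ℝ) :
    (Circle.exp θ : ℂ) + (Circle.exp θ : ℂ)⁻¹ = 2 * Real.cos θ := by
  rw [← Circle.coe_inv, ← Circle.exp_neg, Circle.coe_exp, Circle.coe_exp, Complex.ofReal_cos,
    Complex.ofReal_neg, Complex.two_cos]

theorem circle_exp_re (θ : ℝ) : (Circle.exp θ : ℂ).re = Real.cos θ := by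
  rw [Circle.coe_exp, Complex.exp_ofReal_mul_I_re]

theorem circle_exp_sq_ne_one {θ : ℝ} (hθ : Real.sin θ ≠ 0) : (Circle.exp θ : ℂ) ^ 2 ≠ 1 := by
  intro h
  have hsub := circle_exp_sub_inv θ
  rw [sub_eq_zero.2 (eq_inv_of_mul_eq_one_left (by rw [← sq, h]))] at hsub
  refine mul_ne_zero (mul_ne_zero two_ne_zero ?_) Complex.I_ne_zero hsub.symm
  exact Complex.ofReal_ne_zero.2 hθ

theorem norm_circle_exp_mul_sub_inv (α β : ℝ) :
    ‖(Circle.exp α : ℂ) * (Circle.exp β - (Circle.exp β : ℂ)⁻¹)‖ = 2 * |Real.sin β| := by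
  rw [norm_mul, Circle.norm_coe, circle_exp_sub_inv, norm_mul, norm_mul, Complex.norm_I,
    Complex.norm_real, Complex.norm_ofNat, Real.norm_eq_abs, one_mul, mul_one]

theorem circle_exp_mul_sub_inv_re (α β : ℝ) :
    ((Circle.exp α : ℂ) * (Circle.exp β - (Circle.exp β : ℂ)⁻¹)).re
      = -2 * (Real.sin α * Real.sin β) := by
  rw [circle_exp_sub_inv, ← mul_assoc, Complex.mul_I_re, ← Complex.ofReal_ofNat,
    ← Complex.ofReal_mul, Complex.im_mul_ofReal, Circle.coe_exp, Complex.exp_ofReal_mul_I_im]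
  ring

theorem add_eq_mul_mul_conj_add (p q : Circle) :
    (p + q : ℂ) = p * q * (starRingEnd ℂ) (p + q) := by
  rw [map_add, ← Circle.coe_inv_eq_conj, ← Circle.coe_inv_eq_conj, Circle.coe_inv, Circle.coe_inv]
  field_simp [p.coe_ne_zero, q.coe_ne_zero]
  ring

theorem cos_add_eq_neg_cos_two_mul {α β μ ν : ℝ} (hβ : Real.sin β ≠ 0)
    (h : (Circle.exp α : ℂ) * (Circle.exp β - (Circle.exp β : ℂ)⁻¹)
      = Circle.exp μ + Circle.exp ν) : Real.cos (μ + ν) = -Real.cos (2 * α) := by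
  have hconj := add_eq_mul_mul_conj_add (Circle.exp μ) (Circle.exp ν)
  have hβ' : (Real.sin β : ℂ) ≠ 0 := Complex.ofReal_ne_zero.2 hβ
  have hexp : (Circle.exp μ : ℂ) * Circle.exp ν = -(Circle.exp α * Circle.exp α) := by
    rw [← h, circle_exp_sub_inv, map_mul, ← Circle.coe_inv_eq_conj, Circle.coe_inv] at hconj
    simp only [map_mul, map_ofNat, Complex.conj_ofReal, Complex.conj_I] at hconj
    have := (Circle.exp α).coe_ne_zero
    field_simp at hconj
    linear_combination hconj
  have hre := congrArg Complex.re hexp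
  rwa [← Circle.coe_mul, ← Circle.coe_mul, ← Circle.exp_add, ← Circle.exp_add, Complex.neg_re,
    circle_exp_re, circle_exp_re, ← two_mul] at hre

theorem exists_circle_exp_eq_of_eqOrInv {θ : ℝ} {z : ℂ} (h : EqOrInv (Circle.exp θ : ℂ) z) :
    ∃ θ', (θ' = θ ∨ θ' = -θ) ∧ z = Circle.exp θ' := by
  rcases h with rfl | rfl
  · exact ⟨θ, Or.inl rfl, rfl⟩
  · exact ⟨-θ, Or.inr rfl, by rw [Circle.exp_neg, Circle.coe_inv]⟩

theorem norm_eq_one_and_re_eq_of_eqOrInv {θ : ℝ} {z : ℂ} (h : EqOrInv (Circle.exp θ : ℂ) z) :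
    ‖z‖ = 1 ∧ z.re = Real.cos θ := by
  obtain ⟨θ', rfl | rfl, rfl⟩ := exists_circle_exp_eq_of_eqOrInv h
  · exact ⟨Circle.norm_coe _, circle_exp_re _⟩
  · exact ⟨Circle.norm_coe _, by rw [circle_exp_re, Real.cos_neg]⟩

theorem sin_pos_of_mem_Ioc {γ : ℝ} (hγ : γ ∈ Set.Ioc 0 (Real.pi / 2)) : 0 < Real.sin γ :=
  Real.sin_pos_of_pos_of_lt_pi hγ.1 (by linarith [hγ.2, Real.pi_pos])

theorem sin_eq_sin_iff_of_mem_Icc {θ ψ : ℝ} (hθ : θ ∈ Set.Icc 0 Real.pi)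
    (hψ : ψ ∈ Set.Icc 0 (Real.pi / 2)) :
    Real.sin θ = Real.sin ψ ↔ θ = ψ ∨ θ = Real.pi - ψ := by
  obtain ⟨hθ0, hθπ⟩ := hθ
  obtain ⟨hψ0, hψπ⟩ := hψ
  constructor
  · intro h
    rcases le_total θ (Real.pi / 2) with hle | hle
    · exact Or.inl (Real.injOn_sin ⟨by linarith, hle⟩ ⟨by linarith, hψπ⟩ h)
    · rw [← Real.sin_pi_sub] at h
      have := Real.injOn_sin ⟨by linarith, by linarith⟩ ⟨by linarith, hψπ⟩ h
      exact Or.inr (by linarith)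
  · rintro (rfl | rfl)
    exacts [rfl, Real.sin_pi_sub ψ]

section Classification

variable {α β γ₁ γ₂ : ℝ}

theorem sineCase_of_eq_or_eq (hα : 0 < Real.sin α)
    (h : Real.sin α * Real.sin β = Real.sin γ₁ * Real.sin γ₂) (hγ : α = γ₁ ∨ α = γ₂) :
    SineCase α β γ₁ γ₂ := by
  rcases hγ with rfl | rfl
  · exact Or.inl ⟨rfl, mul_left_cancel₀ hα.ne' h⟩
  · exact Or.inr ⟨rfl, mul_left_cancel₀ hα.ne' (h.trans (mul_comm _ _))⟩

theorem sixthCase_of_sin_eq (hα : α ∈ Set.Ioo 0 (Real.pi / 2)) (hβ : β ∈ Set.Icc 0 Real.pi)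
    (hγ₁ : γ₁ ∈ Set.Icc 0 (Real.pi / 2)) (hβ2 : Real.sin β = 1 / 2)
    (hadd : γ₁ + γ₂ = Real.pi / 2)
    (h : Real.sin α * Real.sin β = Real.sin γ₁ * Real.sin γ₂) : SixthCase α β γ₁ γ₂ := by
  have hγ₂ : γ₂ = Real.pi / 2 - γ₁ := by linarith
  have hπ := Real.pi_pos
  have hsin : Real.sin (2 * γ₁) = Real.sin α := by
    rw [hγ₂, Real.sin_pi_div_two_sub, hβ2] at h
    rw [Real.sin_two_mul]
    linarith
  rw [← Real.sin_pi_div_six, sin_eq_sin_iff_of_mem_Icc hβ ⟨by positivity, by linarith⟩] at hβ2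
  rw [sin_eq_sin_iff_of_mem_Icc ⟨by linarith [hγ₁.1], by linarith [hγ₁.2]⟩
    (Set.Ioo_subset_Icc_self hα)] at hsin
  refine ⟨hβ2.imp_right fun h => by linarith, hsin.imp (fun h => ?_) fun h => ?_⟩ <;>
    constructor <;> linarith

theorem sin_mul_sin_eq_of_sineCase (h : SineCase α β γ₁ γ₂) :
    Real.sin α * Real.sin β = Real.sin γ₁ * Real.sin γ₂ := by
  rcases h with ⟨h₁, h₂⟩ | ⟨h₁, h₂⟩
  · rw [h₁, h₂]
  · rw [h₁, h₂, mul_comm]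

theorem sin_eq_half_of_sixthCase (h : SixthCase α β γ₁ γ₂) : Real.sin β = 1 / 2 := by
  rcases h.1 with rfl | rfl
  · exact Real.sin_pi_div_six
  · rw [← Real.sin_pi_div_six, ← Real.sin_pi_sub]
    ring_nf

theorem add_eq_pi_div_two_of_sixthCase (h : SixthCase α β γ₁ γ₂) : γ₁ + γ₂ = Real.pi / 2 := by
  rcases h.2 with ⟨rfl, rfl⟩ | ⟨rfl, rfl⟩ <;> ring

theorem sin_mul_sin_eq_of_sixthCase (h : SixthCase α β γ₁ γ₂) :
    Real.sin α * Real.sin β = Real.sin γ₁ * Real.sin γ₂ := by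
  have hα : Real.sin α = 2 * Real.sin (α / 2) * Real.cos (α / 2) := by
    rw [← Real.sin_two_mul, mul_div_cancel₀ _ two_ne_zero]
  rw [sin_eq_half_of_sixthCase h, hα]
  rcases h.2 with ⟨rfl, rfl⟩ | ⟨rfl, rfl⟩ <;> rw [Real.sin_pi_div_two_sub] <;> ring

theorem circle_exp_relation (h : Real.sin α * Real.sin β = Real.sin γ₁ * Real.sin γ₂) :
    ((Circle.exp α : ℂ) - (Circle.exp α : ℂ)⁻¹) * (Circle.exp β - (Circle.exp β : ℂ)⁻¹)
      = Circle.exp (γ₁ + γ₂) + (Circle.exp (γ₁ + γ₂) : ℂ)⁻¹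
        + (Circle.exp (γ₁ - γ₂ + Real.pi) + (Circle.exp (γ₁ - γ₂ + Real.pi) : ℂ)⁻¹) := by
  have hcos : 2 * Real.cos (γ₁ + γ₂) + 2 * Real.cos (γ₁ - γ₂ + Real.pi)
      = -4 * (Real.sin α * Real.sin β) := by
    rw [h, Real.cos_add_pi, Real.cos_add, Real.cos_sub]
    ring
  rw [circle_exp_sub_inv, circle_exp_sub_inv, circle_exp_add_inv, circle_exp_add_inv]
  calc 2 * (Real.sin α : ℂ) * Complex.I * (2 * Real.sin β * Complex.I)
      = ((-4 * (Real.sin α * Real.sin β) : ℝ) : ℂ) := by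
        push_cast
        linear_combination 4 * (Complex.sin α * Complex.sin β) * Complex.I_mul_I
    _ = 2 * (Real.cos (γ₁ + γ₂) : ℂ) + 2 * (Real.cos (γ₁ - γ₂ + Real.pi) : ℂ) := by
        rw [← hcos]
        norm_cast

theorem sineCase_of_circle_exp_mul_sub_inv_eq_add (hα : α ∈ Set.Ioo 0 (Real.pi / 2))
    (hβ : Real.sin β ≠ 0) (hγ₁ : γ₁ ∈ Set.Icc 0 (Real.pi / 2)) (hγ₂ : γ₂ ∈ Set.Icc 0 (Real.pi / 2))
    (h : Real.sin α * Real.sin β = Real.sin γ₁ * Real.sin γ₂) {u v : ℂ}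
    (hu : EqOrInv (Circle.exp (γ₁ + γ₂) : ℂ) u)
    (hv : EqOrInv (Circle.exp (γ₁ - γ₂ + Real.pi) : ℂ) v)
    (huv : (Circle.exp α : ℂ) * (Circle.exp β - (Circle.exp β : ℂ)⁻¹) = u + v) :
    SineCase α β γ₁ γ₂ := by
  have eq_of_cos_eq {γ : ℝ} (hγ : γ ∈ Set.Icc 0 (Real.pi / 2))
      (hcos : Real.cos (2 * α) = Real.cos (2 * γ)) : α = γ := by
    have := Real.injOn_cos ⟨by linarith [hα.1], by linarith [hα.2]⟩
      ⟨by linarith [hγ.1], by linarith [hγ.2]⟩ hcos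
    linarith
  obtain ⟨μ, hμ, rfl⟩ := exists_circle_exp_eq_of_eqOrInv hu
  obtain ⟨ν, hν, rfl⟩ := exists_circle_exp_eq_of_eqOrInv hv
  have hcos := cos_add_eq_neg_cos_two_mul hβ huv
  refine sineCase_of_eq_or_eq (Real.sin_pos_of_pos_of_lt_pi hα.1 (by linarith [hα.1, hα.2])) h ?_
  have cos_eq : Real.cos (μ + ν) = -Real.cos (2 * γ₁) ∨ Real.cos (μ + ν) = -Real.cos (2 * γ₂) := by
    rcases hμ with rfl | rfl <;> rcases hν with rfl | rfl
    · left
      rw [← Real.cos_add_pi]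
      ring_nf
    · right
      rw [← Real.cos_sub_pi]
      ring_nf
    · right
      rw [← Real.cos_neg, ← Real.cos_sub_pi]
      ring_nf
    · left
      rw [← Real.cos_neg, ← Real.cos_add_pi]
      ring_nf
  exact cos_eq.imp (fun h => eq_of_cos_eq hγ₁ (by linarith)) fun h => eq_of_cos_eq hγ₂ (by linarith)

theorem sineCase_or_sixthCase_of_hasShortRelation (hα : α ∈ Set.Ioo 0 (Real.pi / 2))
    (hβ : β ∈ Set.Ioo 0 Real.pi) (hγ₁ : γ₁ ∈ Set.Ioc 0 (Real.pi / 2))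
    (hγ₂ : γ₂ ∈ Set.Ioc 0 (Real.pi / 2))
    (h : Real.sin α * Real.sin β = Real.sin γ₁ * Real.sin γ₂)
    (hshort : HasShortRelation ((Circle.exp α : ℂ) * (Circle.exp β - (Circle.exp β : ℂ)⁻¹))
      (Circle.exp (γ₁ + γ₂) : ℂ) (Circle.exp (γ₁ - γ₂ + Real.pi) : ℂ)) :
    SineCase α β γ₁ γ₂ ∨ SixthCase α β γ₁ γ₂ := by
  have hsinβ : 0 < Real.sin β := Real.sin_pos_of_mem_Ioo hβ
  have hγ₁' := Set.Ioc_subset_Icc_self hγ₁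
  have hγ₂' := Set.Ioc_subset_Icc_self hγ₂
  rcases hshort with ⟨u, v, hu, hv, huv⟩ | hu | hv
  · exact Or.inl (sineCase_of_circle_exp_mul_sub_inv_eq_add hα hsinβ.ne' hγ₁' hγ₂' h hu hv huv)
  · exfalso
    have hre := (norm_eq_one_and_re_eq_of_eqOrInv hu).2
    rw [circle_exp_mul_sub_inv_re, h, Real.cos_add] at hre
    have hcos {γ : ℝ} (hγ : γ ∈ Set.Ioc 0 (Real.pi / 2)) : 0 ≤ Real.cos γ :=
      Real.cos_nonneg_of_neg_pi_div_two_le_of_le (by linarith [hγ.1, Real.pi_pos]) hγ.2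
    linarith [mul_pos (sin_pos_of_mem_Ioc hγ₁) (sin_pos_of_mem_Ioc hγ₂),
      mul_nonneg (hcos hγ₁) (hcos hγ₂)]
  · obtain ⟨hnorm, hre⟩ := norm_eq_one_and_re_eq_of_eqOrInv hv
    rw [norm_circle_exp_mul_sub_inv, abs_of_pos hsinβ] at hnorm
    rw [circle_exp_mul_sub_inv_re, h, Real.cos_add_pi, Real.cos_sub] at hre
    have hadd : γ₁ + γ₂ = Real.pi / 2 :=
      Real.injOn_cos ⟨by linarith [hγ₁.1, hγ₂.1], by linarith [hγ₁.2, hγ₂.2]⟩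
        ⟨by positivity, by linarith [Real.pi_pos]⟩
        (by rw [Real.cos_add, Real.cos_pi_div_two]; linarith)
    exact Or.inr (sixthCase_of_sin_eq hα (Set.Ioo_subset_Icc_self hβ) hγ₁' (by linarith) hadd h)

theorem circle_exp_mul_pi_div_pow_eq_one (k : ℕ) {c : ℕ} (hc : c ≠ 0) :
    Circle.exp (k * Real.pi / c) ^ (2 * c) = 1 := by
  rw [← Circle.exp_nsmul, Circle.exp_eq_one]
  refine ⟨k, ?_⟩
  rw [nsmul_eq_mul]
  push_cast
  field_simp

theorem sineCase_or_sixthCase_of_sin_mul_sin_eq {a b c : ℕ} (hab : a.Coprime b) (ha : Odd a)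
    (hb : b ≠ 0) (hc : c ≠ 0) (hα : α ∈ Set.Ioo 0 (Real.pi / 2))
    (hβ : β ∈ Set.Ioo 0 Real.pi) (hγ₁ : γ₁ ∈ Set.Ioc 0 (Real.pi / 2))
    (hγ₂ : γ₂ ∈ Set.Ioc 0 (Real.pi / 2)) (hαa : Circle.exp α ^ (2 * a) = 1)
    (hβb : Circle.exp β ^ (2 * b) = 1) (hγ₁c : Circle.exp γ₁ ^ (2 * c) = 1)
    (hγ₂c : Circle.exp γ₂ ^ (2 * c) = 1)
    (h : Real.sin α * Real.sin β = Real.sin γ₁ * Real.sin γ₂) :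
    SineCase α β γ₁ γ₂ ∨ SixthCase α β γ₁ γ₂ := by
  have hπ : Circle.exp Real.pi ^ (2 * c) = 1 := by
    rw [pow_mul, ← Circle.exp_nsmul, two_nsmul, ← two_mul, Circle.exp_two_pi, one_pow]
  have coe_pow {z : Circle} {n : ℕ} (hz : z ^ n = 1) : (z : ℂ) ^ n = 1 := by
    rw [← Circle.coe_pow, hz, Circle.coe_one]
  have sin_ne_zero {θ : ℝ} (hθ : θ ∈ Set.Ioo 0 Real.pi) : Real.sin θ ≠ 0 :=
    (Real.sin_pos_of_mem_Ioo hθ).ne'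
  refine sineCase_or_sixthCase_of_hasShortRelation hα hβ hγ₁ hγ₂ h
    (hasShortRelation_of_coprime hab ha hb (mul_ne_zero two_ne_zero hc) (even_two_mul c)
      (coe_pow hαa) (circle_exp_sq_ne_one ?_) (coe_pow hβb)
      (circle_exp_sq_ne_one (sin_ne_zero hβ)) (coe_pow ?_) (coe_pow ?_) (circle_exp_relation h))
  · exact sin_ne_zero ⟨hα.1, hα.2.trans (by linarith [Real.pi_pos])⟩
  · rw [Circle.exp_add, mul_pow, hγ₁c, hγ₂c, one_mul]
  · rw [Circle.exp_add, Circle.exp_sub, mul_pow, div_pow, hγ₁c, hγ₂c, hπ, div_one, one_mul]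

end Classification

end Trigonometry

section FactorPoly

variable {α β γ γ₁ γ₂ : ℝ}

/-- A quarter of the discriminant of `P_{α,β,γ}`. It vanishes at `γ = π/2`, so that the root of the
linear polynomial `P_{α,β,π/2}` is described by the same equation as in the quadratic case. -/
noncomputable def quarterDiscrim (α β γ : ℝ) : ℝ :=
  4 * Real.cos γ ^ 2 * (1 - (Real.sin α * Real.sin β / Real.sin γ) ^ 2)

theorem factorPoly_eq_sq_sub (hγ : Real.sin γ ≠ 0) (hγ2 : γ ≠ Real.pi / 2) :
    factorPoly α β γ = (Polynomial.X + Polynomial.C (2 * Real.cos α * Real.cos β)) ^ 2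
      - Polynomial.C (quarterDiscrim α β γ) := by
  have constantCoeff : 4 * ((Real.cos α ^ 2 - Real.cos γ ^ 2) * (Real.cos β ^ 2 - Real.cos γ ^ 2))
      / Real.sin γ ^ 2 = (2 * Real.cos α * Real.cos β) ^ 2 - quarterDiscrim α β γ := by
    rw [quarterDiscrim]
    field_simp
    simp only [Real.sin_sq]
    ring
  rw [factorPoly, if_neg hγ2, constantCoeff]
  simp only [Polynomial.C_mul, Polynomial.C_sub, Polynomial.C_pow, Polynomial.C_ofNat]
  ring

theorem aeval_factorPoly_eq_zero_iff (hγ : Real.sin γ ≠ 0) (φ : ℂ) :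
    Polynomial.aeval φ (factorPoly α β γ) = 0 ↔
      (φ + (2 * Real.cos α * Real.cos β : ℝ)) ^ 2 = (quarterDiscrim α β γ : ℝ) := by
  by_cases hγ2 : γ = Real.pi / 2
  · rw [factorPoly, if_pos hγ2, quarterDiscrim, hγ2, Real.cos_pi_div_two]
    simp
  · rw [factorPoly_eq_sq_sub hγ hγ2, ← sub_eq_zero (a := _ ^ 2)]
    simp

theorem sin_mul_sin_eq_of_quarterDiscrim_eq (hα : 0 < Real.sin α) (hβ : 0 < Real.sin β)
    (hγ₁ : 0 < Real.sin γ₁) (hγ₂ : 0 < Real.sin γ₂) (hne : Real.sin γ₁ ≠ Real.sin γ₂)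
    (h : quarterDiscrim α β γ₁ = quarterDiscrim α β γ₂) :
    Real.sin α * Real.sin β = Real.sin γ₁ * Real.sin γ₂ := by
  have hsq : Real.sin γ₁ ^ 2 - Real.sin γ₂ ^ 2 ≠ 0 := by
    rwa [sub_ne_zero, ne_eq, sq_eq_sq₀ hγ₁.le hγ₂.le]
  rw [← sq_eq_sq₀ (mul_pos hα hβ).le (mul_pos hγ₁ hγ₂).le, ← sub_eq_zero]
  refine (mul_eq_zero.1 ?_).resolve_left hsq
  rw [quarterDiscrim, quarterDiscrim, Real.cos_sq', Real.cos_sq'] at h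
  field_simp at h
  linear_combination h

theorem quarterDiscrim_eq_sq (hγ₁ : Real.sin γ₁ ≠ 0)
    (h : Real.sin α * Real.sin β = Real.sin γ₁ * Real.sin γ₂) :
    quarterDiscrim α β γ₁ = (2 * Real.cos γ₁ * Real.cos γ₂) ^ 2 := by
  rw [quarterDiscrim, h, mul_div_cancel_left₀ _ hγ₁, ← Real.cos_sq']
  ring

theorem isCommonRoot_factorPoly_iff (hγ₁ : Real.sin γ₁ ≠ 0) (hγ₂ : Real.sin γ₂ ≠ 0)
    (h : Real.sin α * Real.sin β = Real.sin γ₁ * Real.sin γ₂) {t : ℝ}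
    (ht : (Real.cos γ₁ * Real.cos γ₂) ^ 2 = t ^ 2) (φ : ℂ) :
    IsCommonRoot (factorPoly α β γ₁) (factorPoly α β γ₂) φ ↔
      φ = (-2 * (Real.cos α * Real.cos β - t) : ℝ) ∨
        φ = (-2 * (Real.cos α * Real.cos β + t) : ℝ) := by
  have h₁ : quarterDiscrim α β γ₁ = (2 * t) ^ 2 := by
    rw [quarterDiscrim_eq_sq hγ₁ h]
    linear_combination 4 * ht
  have h₂ : quarterDiscrim α β γ₂ = (2 * t) ^ 2 := by
    rw [quarterDiscrim_eq_sq hγ₂ (h.trans (mul_comm _ _))]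
    linear_combination 4 * ht
  rw [IsCommonRoot, aeval_factorPoly_eq_zero_iff hγ₁, aeval_factorPoly_eq_zero_iff hγ₂, h₁, h₂,
    and_self, Complex.ofReal_pow, sq_eq_sq_iff_eq_or_eq_neg, ← eq_sub_iff_add_eq,
    ← eq_sub_iff_add_eq]
  push_cast
  ring_nf

theorem isCommonRoot_iff_of_sineCase (hγ₁ : Real.sin γ₁ ≠ 0) (hγ₂ : Real.sin γ₂ ≠ 0)
    (h : SineCase α β γ₁ γ₂) (φ : ℂ) :
    IsCommonRoot (factorPoly α β γ₁) (factorPoly α β γ₂) φ ↔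
      φ = 0 ∨ φ = ((-4 * Real.cos α * Real.cos β : ℝ) : ℂ) := by
  have hcos : (Real.cos γ₁ * Real.cos γ₂) ^ 2 = (Real.cos α * Real.cos β) ^ 2 := by
    simp only [mul_pow, Real.cos_sq']
    rcases h with ⟨h₁, h₂⟩ | ⟨h₁, h₂⟩
    · rw [h₁, h₂]
    · rw [h₁, h₂, mul_comm]
  rw [isCommonRoot_factorPoly_iff hγ₁ hγ₂ (sin_mul_sin_eq_of_sineCase h) hcos]
  ring_nf
  simp only [Complex.ofReal_zero]

theorem isCommonRoot_iff_of_sixthCase (hγ₁ : Real.sin γ₁ ≠ 0) (hγ₂ : Real.sin γ₂ ≠ 0)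
    (h : SixthCase α β γ₁ γ₂) (φ : ℂ) :
    IsCommonRoot (factorPoly α β γ₁) (factorPoly α β γ₂) φ ↔
      φ = ((-2 * Real.cos (α + β) : ℝ) : ℂ) ∨ φ = ((-2 * Real.cos (α - β) : ℝ) : ℂ) := by
  have hsin := sin_mul_sin_eq_of_sixthCase h
  have hcos : Real.cos γ₁ * Real.cos γ₂ = Real.sin α * Real.sin β := by
    rw [hsin, eq_sub_of_add_eq (add_eq_pi_div_two_of_sixthCase h), Real.cos_pi_div_two_sub,
      Real.sin_pi_div_two_sub, mul_comm]
  rw [isCommonRoot_factorPoly_iff hγ₁ hγ₂ hsin (congrArg (· ^ 2) hcos), Real.cos_add, Real.cos_sub]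

theorem factorPoly_eq_of_sin_mul_sin_eq (hγ₁ : Real.sin γ₁ ≠ 0) (hγ₂ : Real.sin γ₂ ≠ 0)
    (hγ₁2 : γ₁ ≠ Real.pi / 2) (hγ₂2 : γ₂ ≠ Real.pi / 2)
    (h : Real.sin α * Real.sin β = Real.sin γ₁ * Real.sin γ₂) :
    factorPoly α β γ₁ = factorPoly α β γ₂ := by
  rw [factorPoly_eq_sq_sub hγ₁ hγ₁2, factorPoly_eq_sq_sub hγ₂ hγ₂2, quarterDiscrim_eq_sq hγ₁ h,
    quarterDiscrim_eq_sq hγ₂ (h.trans (mul_comm _ _)), mul_right_comm 2 (Real.cos γ₁)]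

theorem SineCase.symm (h : SineCase α β γ₁ γ₂) : SineCase α β γ₂ γ₁ := Or.symm h

theorem SixthCase.symm (h : SixthCase α β γ₁ γ₂) : SixthCase α β γ₂ γ₁ := ⟨h.1, h.2.symm⟩

theorem eq_pi_div_two_and_eq_of_sineCase_or_sixthCase (hα : α ∈ Set.Ioo 0 (Real.pi / 2))
    (hβ : β ∈ Set.Icc 0 Real.pi) (hγ : γ ∈ Set.Ioc 0 (Real.pi / 2))
    (h : SineCase α β (Real.pi / 2) γ ∨ SixthCase α β (Real.pi / 2) γ) :
    β = Real.pi / 2 ∧ γ = α := by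
  have hπ := Real.pi_pos
  have hα' : α ∈ Set.Icc (-(Real.pi / 2)) (Real.pi / 2) := ⟨by linarith [hα.1], hα.2.le⟩
  rcases h with (⟨hsin, -⟩ | ⟨hsinα, hsinβ⟩) | h
  · exact absurd (Real.injOn_sin hα' ⟨by linarith, le_rfl⟩ hsin) hα.2.ne
  · refine ⟨?_, (Real.injOn_sin hα' ⟨by linarith [hγ.1], hγ.2⟩ hsinα).symm⟩
    rw [sin_eq_sin_iff_of_mem_Icc hβ ⟨by positivity, le_rfl⟩] at hsinβ
    exact hsinβ.elim id fun h => by linarith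
  · linarith [add_eq_pi_div_two_of_sixthCase h, hγ.1]

theorem factorPoly_eq_or_eq_pi_div_two_of_sineCase_or_sixthCase
    (hα : α ∈ Set.Ioo 0 (Real.pi / 2)) (hβ : β ∈ Set.Icc 0 Real.pi)
    (hγ₁ : γ₁ ∈ Set.Ioc 0 (Real.pi / 2)) (hγ₂ : γ₂ ∈ Set.Ioc 0 (Real.pi / 2))
    (h : SineCase α β γ₁ γ₂ ∨ SixthCase α β γ₁ γ₂) :
    factorPoly α β γ₁ = factorPoly α β γ₂ ∨
      (β = Real.pi / 2 ∧
        ((γ₁ = Real.pi / 2 ∧ γ₂ = α) ∨ (γ₂ = Real.pi / 2 ∧ γ₁ = α))) := by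
  by_cases hγ₁2 : γ₁ = Real.pi / 2
  · subst hγ₁2
    obtain ⟨hβ2, hγα⟩ := eq_pi_div_two_and_eq_of_sineCase_or_sixthCase hα hβ hγ₂ h
    exact Or.inr ⟨hβ2, Or.inl ⟨rfl, hγα⟩⟩
  by_cases hγ₂2 : γ₂ = Real.pi / 2
  · subst hγ₂2
    obtain ⟨hβ2, hγα⟩ := eq_pi_div_two_and_eq_of_sineCase_or_sixthCase hα hβ hγ₁
      (h.imp SineCase.symm SixthCase.symm)
    exact Or.inr ⟨hβ2, Or.inr ⟨rfl, hγα⟩⟩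
  exact Or.inl (factorPoly_eq_of_sin_mul_sin_eq (sin_pos_of_mem_Ioc hγ₁).ne'
    (sin_pos_of_mem_Ioc hγ₂).ne' hγ₁2 hγ₂2
    (h.elim sin_mul_sin_eq_of_sineCase sin_mul_sin_eq_of_sixthCase))

theorem sin_mul_sin_eq_of_isCommonRoot (hα : 0 < Real.sin α) (hβ : 0 < Real.sin β)
    (hγ₁ : γ₁ ∈ Set.Ioc 0 (Real.pi / 2)) (hγ₂ : γ₂ ∈ Set.Ioc 0 (Real.pi / 2)) (hne : γ₁ ≠ γ₂)
    {φ : ℂ} (h : IsCommonRoot (factorPoly α β γ₁) (factorPoly α β γ₂) φ) :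
    Real.sin α * Real.sin β = Real.sin γ₁ * Real.sin γ₂ := by
  have hsin₁ := sin_pos_of_mem_Ioc hγ₁
  have hsin₂ := sin_pos_of_mem_Ioc hγ₂
  have hsin : Real.sin γ₁ ≠ Real.sin γ₂ := Real.injOn_sin.ne
    ⟨by linarith [hγ₁.1, Real.pi_pos], hγ₁.2⟩ ⟨by linarith [hγ₂.1, Real.pi_pos], hγ₂.2⟩ hne
  rw [IsCommonRoot, aeval_factorPoly_eq_zero_iff hsin₁.ne',
    aeval_factorPoly_eq_zero_iff hsin₂.ne'] at h
  exact sin_mul_sin_eq_of_quarterDiscrim_eq hα hβ hsin₁ hsin₂ hsin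
    (Complex.ofReal_injective (h.1.symm.trans h.2))

end FactorPoly

theorem natCast_mul_pi_div_mem_Ioo {k c : ℕ} {m : ℝ} (hm : 0 < m) (hk : 0 < k) (h : m * k < c) :
    k * Real.pi / c ∈ Set.Ioo 0 (Real.pi / m) := by
  have hc : (0 : ℝ) < c := lt_of_le_of_lt (by positivity) h
  refine ⟨by positivity, ?_⟩
  rw [div_lt_div_iff₀ hc hm]
  linarith [mul_lt_mul_of_pos_right h Real.pi_pos]

theorem natCast_mul_pi_div_mem_Ioc {k c : ℕ} {m : ℝ} (hm : 0 < m) (hk : 0 < k) (h : m * k ≤ c) :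
    k * Real.pi / c ∈ Set.Ioc 0 (Real.pi / m) := by
  have hc : (0 : ℝ) < c := lt_of_lt_of_le (by positivity) h
  refine ⟨by positivity, ?_⟩
  rw [div_le_div_iff₀ hc hm]
  linarith [mul_le_mul_of_nonneg_right h Real.pi_pos.le]

theorem mainTheorem12 (a b c i j k₁ k₂ : ℕ) (hab : Nat.Coprime a b) (ha : Odd a)
    (hi : 1 ≤ i) (hia : 2 * i < a) (hj : 1 ≤ j) (hjb : j < b)
    (hk₁ : 1 ≤ k₁) (hk₁c : 2 * k₁ ≤ c) (hk₂ : 1 ≤ k₂) (hk₂c : 2 * k₂ ≤ c)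
    (α β γ₁ γ₂ : ℝ)
    (hα : α = (i : ℝ) * Real.pi / (a : ℝ)) (hβ : β = (j : ℝ) * Real.pi / (b : ℝ))
    (hγ₁ : γ₁ = (k₁ : ℝ) * Real.pi / (c : ℝ)) (hγ₂ : γ₂ = (k₂ : ℝ) * Real.pi / (c : ℝ))
    (hne : γ₁ ≠ γ₂) :
    ((∃ φ : ℂ, IsCommonRoot (factorPoly α β γ₁) (factorPoly α β γ₂) φ) ↔
      (factorPoly α β γ₁ = factorPoly α β γ₂ ∨
        (β = Real.pi / 2 ∧
          ((γ₁ = Real.pi / 2 ∧ γ₂ = α) ∨ (γ₂ = Real.pi / 2 ∧ γ₁ = α)))) ∧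
      (SineCase α β γ₁ γ₂ ∨ SixthCase α β γ₁ γ₂)) ∧
    (SineCase α β γ₁ γ₂ →
      ∀ φ : ℂ, IsCommonRoot (factorPoly α β γ₁) (factorPoly α β γ₂) φ ↔
        φ = 0 ∨ φ = ((-4 * Real.cos α * Real.cos β : ℝ) : ℂ)) ∧
    (SixthCase α β γ₁ γ₂ →
      ∀ φ : ℂ, IsCommonRoot (factorPoly α β γ₁) (factorPoly α β γ₂) φ ↔
        φ = ((-2 * Real.cos (α + β) : ℝ) : ℂ) ∨ φ = ((-2 * Real.cos (α - β) : ℝ) : ℂ)) := by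
  subst hα hβ hγ₁ hγ₂
  have hα := natCast_mul_pi_div_mem_Ioo (m := 2) two_pos hi (by exact_mod_cast hia)
  have hβ := natCast_mul_pi_div_mem_Ioo (m := 1) one_pos hj (by rw [one_mul]; exact_mod_cast hjb)
  have hγ₁ := natCast_mul_pi_div_mem_Ioc (m := 2) two_pos hk₁ (by exact_mod_cast hk₁c)
  have hγ₂ := natCast_mul_pi_div_mem_Ioc (m := 2) two_pos hk₂ (by exact_mod_cast hk₂c)
  rw [div_one] at hβ
  have hsin₁ := (sin_pos_of_mem_Ioc hγ₁).ne'
  have hsin₂ := (sin_pos_of_mem_Ioc hγ₂).ne'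
  refine ⟨⟨?_, ?_⟩, isCommonRoot_iff_of_sineCase hsin₁ hsin₂,
    isCommonRoot_iff_of_sixthCase hsin₁ hsin₂⟩
  · rintro ⟨φ, hφ⟩
    have hsin := sin_mul_sin_eq_of_isCommonRoot
      (sin_pos_of_mem_Ioc (Set.Ioo_subset_Ioc_self hα)) (Real.sin_pos_of_mem_Ioo hβ) hγ₁ hγ₂ hne hφ
    have hcases := sineCase_or_sixthCase_of_sin_mul_sin_eq hab ha (by omega) (by omega)
      hα hβ hγ₁ hγ₂ (circle_exp_mul_pi_div_pow_eq_one i (by omega))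
      (circle_exp_mul_pi_div_pow_eq_one j (by omega))
      (circle_exp_mul_pi_div_pow_eq_one k₁ (by omega))
      (circle_exp_mul_pi_div_pow_eq_one k₂ (by omega)) hsin
    exact ⟨factorPoly_eq_or_eq_pi_div_two_of_sineCase_or_sixthCase hα
      (Set.Ioo_subset_Icc_self hβ) hγ₁ hγ₂ hcases, hcases⟩
  · rintro ⟨-, hsine | hsixth⟩
    · exact ⟨0, (isCommonRoot_iff_of_sineCase hsin₁ hsin₂ hsine 0).2 (Or.inl rfl)⟩
    · exact ⟨_, (isCommonRoot_iff_of_sixthCase hsin₁ hsin₂ hsixth _).2 (Or.inl rfl)⟩
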